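/- Let $R$ be a domain, that is, a nonzero associative ring with identity, not necessarily commutative, in which $ab=0$ implies $a=0$ or $b=0$. Assume that $R$ is a Bézout domain: every finitely generated right ideal and every finitely generated left ideal of $R$ is principal. An element $a$ of a ring $S$ is called singular if there are nonzero $b,c\in S$ with $ab=0$ and $ca=0$; a singular $n\times n$ matrix over $R$ is a singular element of the matrix ring $M_n(R)$. For a ring $R$ we say that - $R$ has the $IP_2$ property if every singular $2\times 2$ matrix over $R$ is a product of idempotent matrices; - $R$ has the $IP$ property if, for every $n$, every singular $n\times n$ matrix over $R$ is a product of idempotent $n\times n$ matrices; - $R$ has the $GE_2$ property if every invertible $2\times 2$ matrix over $R$ is a product of elementary matrices $I_2+c\,e_{ij}$ ($c\in R$, $i\neq j$) and diagonal matrices with invertible diagonal entries; - $R$ has stable range $1$ if for all $a,b\in R$ with $aR+bR=R$ there is $x\in R$ such that $a+bx$ is invertible. Then: 1. If the Bézout domain $R$ has the $IP_2$ property and the $GE_2$ property, then $R$ has the $IP$ property. 2. In particular, if the Bézout domain $R$ has stable range $1$, then $R$ has the $IP$ property. -/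

import Mathlib

namespace IdempotentProducts

/-- `R` is right Bézout: every finitely generated right ideal is principal.  Right ideals of `R`
are the `Rᵐᵒᵖ`-submodules of `R`. -/
def IsRightBezout (R : Type*) [Ring R] : Prop :=
  ∀ I : Submodule Rᵐᵒᵖ R, I.FG → I.IsPrincipal

/-- `R` is left Bézout: every finitely generated left ideal is principal. -/
def IsLeftBezout (R : Type*) [Ring R] : Prop :=
  ∀ I : Submodule R R, I.FG → I.IsPrincipal

/-- A (two-sided) Bézout ring. -/
def IsBezoutRing (R : Type*) [Ring R] : Prop :=
  IsRightBezout R ∧ IsLeftBezout R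

/-- `a` is right singular: its right annihilator `{b | a * b = 0}` is nonzero. -/
def IsRightSingular {S : Type*} [Ring S] (a : S) : Prop :=
  ∃ b : S, b ≠ 0 ∧ a * b = 0

/-- `a` is left singular: its left annihilator `{b | b * a = 0}` is nonzero. -/
def IsLeftSingular {S : Type*} [Ring S] (a : S) : Prop :=
  ∃ b : S, b ≠ 0 ∧ b * a = 0

/-- `a` is singular: it is both left and right singular. -/
def IsSingular {S : Type*} [Ring S] (a : S) : Prop :=
  IsLeftSingular a ∧ IsRightSingular a

/-- `a` is a (finite) product of idempotent elements of `S`. -/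
def IsProdOfIdempotents {S : Type*} [Ring S] (a : S) : Prop :=
  ∃ l : List S, (∀ e ∈ l, IsIdempotentElem e) ∧ l.prod = a

/-- Every singular `n × n` matrix over `R` is a product of idempotent `n × n` matrices. -/
def HasIPn (R : Type*) [Ring R] (n : ℕ) : Prop :=
  ∀ A : Matrix (Fin n) (Fin n) R, IsSingular A → IsProdOfIdempotents A

/-- The property `IP₂`. -/
def HasIP2 (R : Type*) [Ring R] : Prop :=
  HasIPn R 2

/-- The property `IP`: every singular square matrix is a product of idempotent matrices. -/
def HasIP (R : Type*) [Ring R] : Prop :=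
  ∀ n : ℕ, HasIPn R n

/-- An elementary matrix `1 + c eᵢⱼ` with `i ≠ j`. -/
def IsElementary {R : Type*} [Ring R] {n : ℕ} (M : Matrix (Fin n) (Fin n) R) : Prop :=
  ∃ (i j : Fin n) (c : R), i ≠ j ∧ M = 1 + Matrix.single i j c

/-- A diagonal matrix with invertible diagonal entries. -/
def IsUnitDiagonal {R : Type*} [Ring R] {n : ℕ} (M : Matrix (Fin n) (Fin n) R) : Prop :=
  ∃ d : Fin n → R, (∀ i, IsUnit (d i)) ∧ M = Matrix.diagonal d

/-- `R` is `GE₂`: every invertible `2 × 2` matrix is a product of elementary matrices and diagonal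
matrices with invertible diagonal entries. -/
def IsGE2 (R : Type*) [Ring R] : Prop :=
  ∀ A : Matrix (Fin 2) (Fin 2) R, IsUnit A →
    ∃ l : List (Matrix (Fin 2) (Fin 2) R),
      (∀ M ∈ l, IsElementary M ∨ IsUnitDiagonal M) ∧ l.prod = A

/-- `R` has stable range `1`: whenever `aR + bR = R`, some `a + b x` is a unit. -/
def HasStableRangeOne (R : Type*) [Ring R] : Prop :=
  ∀ a b : R, Submodule.span Rᵐᵒᵖ {a} ⊔ Submodule.span Rᵐᵒᵖ {b} = (⊤ : Submodule Rᵐᵒᵖ R) →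
    ∃ x : R, IsUnit (a + b * x)

end IdempotentProducts

/-! Let `e` be the identity matrix with row `l` erased. The units `Q` for which `e Q` is a product
of idempotents form a submonoid, because `e Q₁ Q₂ = (e Q₂)(Q₂⁻¹ e Q₁ Q₂)` and conjugates of
idempotents are idempotent. It contains all elementary matrices, hence under GE₂ every embedded
invertible 2 × 2 block (`IsGE2.map_embedMatrix_mem`). Over a right Bézout domain such blocks reduce
any row to a single entry (`exists_unit_clear`). A left singular matrix is therefore conjugate to
one with a zero row, from which the other rows are split off one by one (`mem_of_row_eq_zero`).
Stable range 1 yields GE₂ by Gaussian elimination. -/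

namespace IdempotentProducts

open Matrix

/-! ### Products of idempotents and conjugation by units -/

section Monoid

/-- The products of idempotent elements of a ring, as a submonoid. -/
def idempotentProducts (S : Type*) [Ring S] : Submonoid S :=
  Submonoid.closure {e | IsIdempotentElem e}

theorem IsProdOfIdempotents.of_mem {S : Type*} [Ring S] {a : S}
    (h : a ∈ idempotentProducts S) : IsProdOfIdempotents a :=
  Submonoid.exists_list_of_mem_closure h

theorem mem_idempotentProducts_of_isIdempotentElem {S : Type*} [Ring S] {a : S}
    (h : IsIdempotentElem a) : a ∈ idempotentProducts S :=
  Submonoid.subset_closure h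

theorem conj_mem_idempotentProducts {S : Type*} [Ring S] (Q : Sˣ) {a : S}
    (h : a ∈ idempotentProducts S) : ↑Q⁻¹ * a * ↑Q ∈ idempotentProducts S := by
  induction h using Submonoid.closure_induction with
  | mem x hx =>
    apply mem_idempotentProducts_of_isIdempotentElem
    have hx : x * x = x := hx
    change ↑Q⁻¹ * x * ↑Q * (↑Q⁻¹ * x * ↑Q) = ↑Q⁻¹ * x * ↑Q
    calc ↑Q⁻¹ * x * ↑Q * (↑Q⁻¹ * x * ↑Q) = ↑Q⁻¹ * x * (↑Q * ↑Q⁻¹) * x * ↑Q := by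
          simp only [mul_assoc]
      _ = ↑Q⁻¹ * (x * x) * ↑Q := by simp only [Units.mul_inv, mul_one, mul_assoc]
      _ = _ := by rw [hx]
  | one => simp [one_mem]
  | mul x y _ _ hx hy =>
    have : (↑Q⁻¹ * (x * y) * ↑Q : S) = (↑Q⁻¹ * x * ↑Q) * (↑Q⁻¹ * y * ↑Q) := by
      simp [mul_assoc]
    rw [this]
    exact mul_mem hx hy

/-- For an idempotent `e`, the units `Q` for which `e * Q` is a product of idempotents. -/
def unitsMulMem {S : Type*} [Ring S] (e : S) (he : IsIdempotentElem e) : Submonoid Sˣ where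
  carrier := {Q | e * ↑Q ∈ idempotentProducts S}
  one_mem' := by simpa using mem_idempotentProducts_of_isIdempotentElem he
  mul_mem' {Q₁ Q₂} h₁ h₂ := by
    have : e * ↑(Q₁ * Q₂) = (e * ↑Q₂) * (↑Q₂⁻¹ * (e * ↑Q₁) * ↑Q₂) := by
      calc e * ↑(Q₁ * Q₂) = (e * e) * ↑Q₁ * ↑Q₂ := by rw [he]; simp [mul_assoc]
        _ = _ := by simp only [mul_assoc, Units.mul_inv_cancel_left]
    change e * ↑(Q₁ * Q₂) ∈ idempotentProducts S
    rw [this]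
    exact mul_mem h₂ (conj_mem_idempotentProducts Q₂ h₁)

theorem mem_unitsMulMem {S : Type*} [Ring S] {e : S} {he : IsIdempotentElem e} {Q : Sˣ} :
    Q ∈ unitsMulMem e he ↔ e * ↑Q ∈ idempotentProducts S := Iff.rfl

end Monoid

/-! ### Identity matrices with one or two modified rows -/

section UpdateRow

theorem one_apply_eq_single {R ι : Type*} [Ring R] [DecidableEq ι] (i : ι) :
    (1 : Matrix ι ι R) i = Pi.single i 1 := by
  ext j; simp [Matrix.one_apply, Pi.single_apply, eq_comm]

theorem one_add_single_eq_updateRow {R ι : Type*} [Ring R] [DecidableEq ι] (i j : ι) (c : R) :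
    1 + single i j c = updateRow (1 : Matrix ι ι R) i (Pi.single i 1 + Pi.single j c) := by
  ext a b
  by_cases h : a = i
  · subst h; simp [Matrix.one_apply, Pi.single_apply, Matrix.single_apply, eq_comm]
  · simp [h, Ne.symm h]

variable {R ι : Type*} [Ring R] [Fintype ι] [DecidableEq ι]

theorem vecMul_updateRow_of_eq_zero (v : ι → R) (A : Matrix ι ι R) (i : ι) (r : ι → R)
    (h : v i = 0) : v ᵥ* A.updateRow i r = v ᵥ* A := by
  ext j
  simp only [vecMul, dotProduct]
  refine Finset.sum_congr rfl fun k _ => ?_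
  by_cases hk : k = i
  · subst hk; simp [h]
  · rw [updateRow_ne hk]

theorem single_one_vecMul_eq (A : Matrix ι ι R) (i : ι) : Pi.single i (1 : R) ᵥ* A = A i := by
  rw [single_vecMul]; simp [Matrix.row]

theorem isIdempotentElem_updateRow_one (i : ι) (r : ι → R) (h : r i = 0) :
    IsIdempotentElem (updateRow (1 : Matrix ι ι R) i r) := by
  unfold IsIdempotentElem
  rw [updateRow_mul, one_mul, vecMul_updateRow_of_eq_zero _ _ _ _ h, vecMul_one, updateRow_idem]

theorem updateRow_zero_one_mul (l : ι) (A : Matrix ι ι R) :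
    updateRow (1 : Matrix ι ι R) l 0 * A = updateRow A l 0 := by
  rw [updateRow_mul, one_mul, zero_vecMul]

/-- Row `l` serves as scratch space: reading the factors from the right, store `r` in row `l`, copy
row `l` to row `k`, erase row `l`. Each operation is idempotent. -/
theorem updateRow_updateRow_mem (k l : ι) (hkl : k ≠ l) (r : ι → R) (h : r l = 0) :
    updateRow (updateRow (1 : Matrix ι ι R) k r) l 0 ∈ idempotentProducts (Matrix ι ι R) := by
  have : updateRow (updateRow (1 : Matrix ι ι R) k r) l 0 =
      updateRow 1 l 0 * (updateRow 1 k (Pi.single l 1) * updateRow 1 l r) := by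
    rw [updateRow_mul 1 k, one_mul, single_one_vecMul_eq, updateRow_self, updateRow_zero_one_mul,
      updateRow_comm _ hkl.symm, updateRow_idem, updateRow_comm _ hkl]
  rw [this]
  refine mul_mem ?_ (mul_mem ?_ ?_) <;> apply mem_idempotentProducts_of_isIdempotentElem <;>
    apply isIdempotentElem_updateRow_one
  · rfl
  · simp [hkl]
  · exact h

theorem isIdempotentElem_updateRow_zero_one (R : Type*) [Ring R] (l : ι) :
    IsIdempotentElem (updateRow (1 : Matrix ι ι R) l 0) :=
  isIdempotentElem_updateRow_one l 0 rfl

/-- The case `i = j` is allowed, so that diagonal factors `1 + (u - 1) eᵢᵢ` are covered too. -/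
theorem updateRow_zero_one_mul_one_add_single_mem (l i j : ι) (c : R) :
    updateRow 1 l 0 * (1 + single i j c) ∈ idempotentProducts (Matrix ι ι R) := by
  rw [one_add_single_eq_updateRow, updateRow_zero_one_mul]
  by_cases hi : i = l
  · subst hi
    rw [updateRow_idem]
    exact mem_idempotentProducts_of_isIdempotentElem (isIdempotentElem_updateRow_zero_one R i)
  by_cases hj : j = l
  · subst hj
    apply mem_idempotentProducts_of_isIdempotentElem
    rw [← updateRow_zero_one_mul, ← one_add_single_eq_updateRow]
    have h : single i j c * updateRow (1 : Matrix ι ι R) j 0 = 0 := by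
      ext a b
      by_cases ha : a = i <;> simp [ha]
    calc _ = updateRow 1 j 0 * (updateRow 1 j 0 + single i j c * updateRow 1 j 0) *
            (1 + single i j c) := by noncomm_ring
      _ = _ := by rw [h, add_zero, isIdempotentElem_updateRow_zero_one R j]
  · exact updateRow_updateRow_mem i l hi _ (by simp [Ne.symm hi, Ne.symm hj])

end UpdateRow

/-! ### Embedding small blocks in larger matrices -/

section Embedding

variable {R ι κ : Type*} [Ring R] [Fintype ι] [DecidableEq ι] [Fintype κ] [DecidableEq κ]

/-- The embedding of `κ × κ` matrices in `ι × ι` matrices along an embedding `κ ↪ ι`, with an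
identity block on the complement. -/
def embedMatrix (R : Type*) [Ring R] (f : κ ↪ ι) : Matrix κ κ R →* Matrix ι ι R where
  toFun X := 1 + (1 : Matrix ι ι R).submatrix id f * (X - 1) * (1 : Matrix ι ι R).submatrix f id
  map_one' := by simp
  map_mul' X Y := by
    have h : (1 : Matrix ι ι R).submatrix f id * (1 : Matrix ι ι R).submatrix id f = 1 := by
      rw [← submatrix_mul _ _ f id f Function.bijective_id, one_mul, submatrix_one f f.injective]
    have h' : (1 : Matrix ι ι R).submatrix id f * (X - 1) * (1 : Matrix ι ι R).submatrix f id *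
        ((1 : Matrix ι ι R).submatrix id f * (Y - 1) * (1 : Matrix ι ι R).submatrix f id) =
        (1 : Matrix ι ι R).submatrix id f * ((X - 1) * (Y - 1)) *
          (1 : Matrix ι ι R).submatrix f id := by
      calc _ = (1 : Matrix ι ι R).submatrix id f * (X - 1) * ((1 : Matrix ι ι R).submatrix f id *
        (1 : Matrix ι ι R).submatrix id f) * (Y - 1) * (1 : Matrix ι ι R).submatrix f id := by
            simp only [Matrix.mul_assoc]
        _ = _ := by rw [h, Matrix.mul_one]; simp only [Matrix.mul_assoc]
    rw [mul_add, add_mul _ _ (_ * _), h', mul_one, one_mul, add_assoc, ← Matrix.add_mul,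
      ← Matrix.mul_add, ← Matrix.add_mul, ← Matrix.mul_add]
    congr 4
    noncomm_ring

theorem embedMatrix_apply (f : κ ↪ ι) (X : Matrix κ κ R) : embedMatrix R f X =
    1 + (1 : Matrix ι ι R).submatrix id f * (X - 1) * (1 : Matrix ι ι R).submatrix f id := rfl

theorem embedMatrix_one_add_single (f : κ ↪ ι) (p q : κ) (c : R) :
    embedMatrix R f (1 + single p q c) = 1 + single (f p) (f q) c := by
  rw [embedMatrix_apply, add_sub_cancel_left]
  congr 1
  ext a b
  simp only [Matrix.mul_apply, submatrix_apply, id, Matrix.single_apply, Matrix.one_apply, ite_and,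
    mul_ite, ite_mul, mul_zero, zero_mul, mul_one, one_mul, Finset.sum_ite_eq, Finset.mem_univ,
    if_true, eq_comm (a := a)]
  rw [Finset.sum_eq_single q (by simp +contextual [eq_comm]) (by simp)]
  grind

theorem vecMul_embedMatrix_of_notMem (f : κ ↪ ι) (X : Matrix κ κ R) (v : ι → R) (m : ι)
    (hm : ∀ p, m ≠ f p) : (v ᵥ* embedMatrix R f X) m = v m := by
  rw [embedMatrix_apply, vecMul_add, vecMul_one, ← vecMul_vecMul, Pi.add_apply]
  simp [vecMul, dotProduct, fun p => (hm p).symm]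

theorem vecMul_embedMatrix_apply (f : κ ↪ ι) (X : Matrix κ κ R) (v : ι → R) (q : κ) :
    (v ᵥ* embedMatrix R f X) (f q) = ((v ∘ f) ᵥ* X) q := by
  have h₁ : v ᵥ* (1 : Matrix ι ι R).submatrix id f = v ∘ f := by
    ext p; simp [vecMul, dotProduct, Matrix.one_apply]
  have h₂ (w : κ → R) : (w ᵥ* (1 : Matrix ι ι R).submatrix f id) (f q) = w q := by
    simp [vecMul, dotProduct, Matrix.one_apply]
  rw [embedMatrix_apply, vecMul_add, vecMul_one, ← vecMul_vecMul, ← vecMul_vecMul, Pi.add_apply,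
    h₁, h₂, vecMul_sub, vecMul_one]
  simp

theorem embedMatrix_row_of_notMem (f : κ ↪ ι) (X : Matrix κ κ R) (m : ι)
    (hm : ∀ p, m ≠ f p) : embedMatrix R f X m = Pi.single m 1 := by
  rw [← single_one_vecMul_eq (embedMatrix R f X)]
  ext j
  by_cases hj : ∃ q, j = f q
  · obtain ⟨q, rfl⟩ := hj
    rw [vecMul_embedMatrix_apply]
    have : (Pi.single m (1 : R) : ι → R) ∘ f = 0 := by ext p; simp [(hm p).symm]
    rw [this]; simp [(hm q).symm]
  · push Not at hj
    rw [vecMul_embedMatrix_of_notMem _ _ _ _ hj]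

end Embedding

/-! ### Reducing a row of length two -/

section Hermite

variable {R : Type*} [Ring R]

theorem IsRightBezout.exists_gcd (hR : IsRightBezout R) (a b : R) :
    ∃ d a' b' x y : R, a = d * a' ∧ b = d * b' ∧ d = a * x + b * y := by
  obtain ⟨d, hd⟩ := (hR (Submodule.span Rᵐᵒᵖ {a, b})
    (Submodule.fg_span (by simp))).principal
  have ha : a ∈ Submodule.span Rᵐᵒᵖ {d} := hd ▸ Submodule.subset_span (by simp)
  have hb : b ∈ Submodule.span Rᵐᵒᵖ {d} := hd ▸ Submodule.subset_span (by simp)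
  have hd' : d ∈ Submodule.span Rᵐᵒᵖ {a, b} := hd ▸ Submodule.mem_span_singleton_self d
  obtain ⟨a', ha'⟩ := Submodule.mem_span_singleton.1 ha
  obtain ⟨b', hb'⟩ := Submodule.mem_span_singleton.1 hb
  obtain ⟨x, y, hxy⟩ := Submodule.mem_span_pair.1 hd'
  exact ⟨d, a'.unop, b'.unop, x.unop, y.unop, ha'.symm, hb'.symm, hxy.symm⟩

/-- A unimodular row of length two over a right Bézout domain is the first row of an invertible
matrix. -/
theorem IsRightBezout.exists_unit_of_unimodular [IsDomain R] (hR : IsRightBezout R) (a b x y : R)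
    (ha : a ≠ 0) (h : a * x + b * y = 1) :
    ∃ Q : (Matrix (Fin 2) (Fin 2) R)ˣ, ![a, b] ᵥ* (Q : Matrix (Fin 2) (Fin 2) R) = ![1, 0] := by
  -- The columns of `1 - (x, y)ᵀ(a, b)` span the kernel of the row. As `a ≠ 0`, a kernel vector is
  -- determined by its second coordinate, so a generator `z` of the ideal of second coordinates
  -- gives a basis of the kernel.
  obtain ⟨z, s, t, p, q, hs, ht, hz⟩ := hR.exists_gcd (-(y * a)) (1 - y * b)
  -- the kernel of the row, generated by `(u, z)`
  obtain ⟨u, hu⟩ : ∃ u, u = (1 - x * a) * p + (-(x * b)) * q := ⟨_, rfl⟩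
  have key₁ : a * (1 - x * a) + b * (-(y * a)) = 0 := by
    calc _ = a - (a * x + b * y) * a := by noncomm_ring
      _ = 0 := by rw [h]; simp
  have key₂ : a * (-(x * b)) + b * (1 - y * b) = 0 := by
    calc _ = b - (a * x + b * y) * b := by noncomm_ring
      _ = 0 := by rw [h]; simp
  have hker : a * u + b * z = 0 := by
    calc _ = (a * (1 - x * a) + b * (-(y * a))) * p + (a * (-(x * b)) + b * (1 - y * b)) * q := by
          rw [hu, hz]; noncomm_ring
      _ = 0 := by rw [key₁, key₂]; simp
  have inj {v w₁ w₂ : R} (h₁ : a * w₁ + v = 0) (h₂ : a * w₂ + v = 0) : w₁ = w₂ :=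
    mul_left_cancel₀ ha (add_right_cancel (h₁.trans h₂.symm))
  have hus : u * s = 1 - x * a := by
    refine inj (v := b * (z * s)) ?_ (hs ▸ key₁)
    rw [← mul_assoc, ← mul_assoc, ← add_mul, hker, zero_mul]
  have hut : u * t = -(x * b) := by
    refine inj (v := b * (z * t)) ?_ (ht ▸ key₂)
    rw [← mul_assoc, ← mul_assoc, ← add_mul, hker, zero_mul]
  have hne : z ≠ 0 := by
    rintro rfl
    rw [zero_mul] at hs ht
    have h1 : y * a = 0 := neg_eq_zero.1 hs
    have h2 : y = 0 := (mul_eq_zero.1 h1).resolve_right ha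
    simp [h2] at ht
  have h₃ : s * x + t * y = 0 := by
    refine mul_left_cancel₀ hne ?_
    calc z * (s * x + t * y) = (z * s) * x + (z * t) * y := by noncomm_ring
      _ = y - y * (a * x + b * y) := by rw [← hs, ← ht]; noncomm_ring
      _ = z * 0 := by rw [h]; simp
  have h₄ : s * u + t * z = 1 := by
    refine mul_left_cancel₀ hne ?_
    calc z * (s * u + t * z) = (z * s) * u + (z * t) * z := by noncomm_ring
      _ = z - y * (a * u + b * z) := by rw [← hs, ← ht]; noncomm_ring
      _ = z * 1 := by rw [hker]; simp
  refine ⟨⟨!![x, u; y, z], !![a, b; s, t], ?_, ?_⟩, ?_⟩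
  · rw [mul_fin_two, one_fin_two, hus, hut, ← hs, ← ht]
    simp
  · rw [mul_fin_two, one_fin_two, h, hker, h₃, h₄]
  · ext i
    fin_cases i <;> simp [vecMul, dotProduct, Fin.sum_univ_two, h, hker]

theorem IsRightBezout.exists_unit_vecMul_eq [IsDomain R] (hR : IsRightBezout R) (a b : R) :
    ∃ (Q : (Matrix (Fin 2) (Fin 2) R)ˣ) (d : R),
      ![a, b] ᵥ* (Q : Matrix (Fin 2) (Fin 2) R) = ![d, 0] := by
  by_cases ha : a = 0
  · subst ha
    refine ⟨⟨!![0, 1; 1, 0], !![0, 1; 1, 0], by simp [one_fin_two], by simp [one_fin_two]⟩, b, ?_⟩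
    ext i
    fin_cases i <;> simp [vecMul, dotProduct, Fin.sum_univ_two]
  obtain ⟨d, a', b', x, y, h₁, h₂, h₃⟩ := hR.exists_gcd a b
  have hd : d ≠ 0 := by rintro rfl; simp [h₁] at ha
  have ha' : a' ≠ 0 := by rintro rfl; simp [h₁] at ha
  have h : a' * x + b' * y = 1 := by
    refine mul_left_cancel₀ hd ?_
    rw [mul_add, ← mul_assoc, ← mul_assoc, ← h₁, ← h₂, ← h₃, mul_one]
  obtain ⟨Q, hQ⟩ := hR.exists_unit_of_unimodular a' b' x y ha' h
  refine ⟨Q, d, ?_⟩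
  have : ![a, b] = d • ![a', b'] := by simp [h₁, h₂]
  rw [this, smul_vecMul, hQ]
  simp

end Hermite

/-! ### Column reduction and factorization under GE₂ -/

section GE

theorem one_add_single_sub_one_eq_diagonal {R ι : Type*} [Ring R] [DecidableEq ι] (i : ι) (u : R) :
    1 + single i i (u - 1) = diagonal (Function.update 1 i u) := by
  ext a b
  by_cases hab : a = b
  · subst hab
    by_cases ha : a = i
    · subst ha; simp
    · simp [ha, Ne.symm ha]
  · simp [hab, Matrix.single_apply]
    grind

variable {R ι : Type*} [Ring R] [Fintype ι] [DecidableEq ι]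

/-- The units `Q` of the matrix ring such that `Q`, with its `l`-th row replaced by zero, is a
product of idempotents. -/
abbrev rowErasable (R : Type*) [Ring R] (l : ι) : Submonoid (Matrix ι ι R)ˣ :=
  unitsMulMem (updateRow 1 l 0) (isIdempotentElem_updateRow_zero_one R l)

theorem mem_rowErasable_of_eq_embedMatrix {κ : Type*} [Fintype κ] [DecidableEq κ] (f : κ ↪ ι)
    (l : ι) (Y : (Matrix κ κ R)ˣ) (p q : κ) (c : R) (hY : (Y : Matrix κ κ R) = 1 + single p q c) :
    Units.map (embedMatrix R f) Y ∈ rowErasable R l := by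
  rw [mem_unitsMulMem, Units.coe_map, hY, embedMatrix_one_add_single]
  exact updateRow_zero_one_mul_one_add_single_mem l _ _ c

theorem isUnit_one_add_single {i j : ι} (hij : i ≠ j) (c : R) :
    IsUnit (1 + single i j c : Matrix ι ι R) := by
  have h (c : R) : (1 + single i j c) * (1 + single i j (-c)) = (1 : Matrix ι ι R) := by
    rw [mul_add, add_mul, add_mul, single_mul_single_of_ne _ _ _ _ hij.symm]
    simp [add_assoc, ← single_add]
  exact ⟨⟨_, _, h c, by simpa using h (-c)⟩, rfl⟩

theorem isUnit_diagonal {d : ι → R} (hd : ∀ i, IsUnit (d i)) : IsUnit (diagonal d) := by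
  choose u hu using hd
  refine ⟨⟨diagonal d, diagonal fun i => ↑(u i)⁻¹, ?_, ?_⟩, rfl⟩ <;>
    simp [diagonal_mul_diagonal, ← hu]

theorem diagonal_fin_two_eq (d : Fin 2 → R) :
    diagonal d = (1 + single 0 0 (d 0 - 1)) * (1 + single 1 1 (d 1 - 1)) := by
  rw [one_add_single_sub_one_eq_diagonal, one_add_single_sub_one_eq_diagonal,
    diagonal_mul_diagonal]
  congr 1
  ext i
  fin_cases i <;> simp

theorem IsGE2.map_embedMatrix_mem (hGE : IsGE2 R) (f : Fin 2 ↪ ι) (l : ι)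
    (X : (Matrix (Fin 2) (Fin 2) R)ˣ) : Units.map (embedMatrix R f) X ∈ rowErasable R l := by
  obtain ⟨L, hL, hX⟩ := hGE X X.isUnit
  induction L generalizing X with
  | nil =>
    have : X = 1 := Units.ext (by simpa using hX.symm)
    rw [this, map_one]
    exact one_mem _
  | cons M L ih =>
    have hM : ∃ Y : (Matrix (Fin 2) (Fin 2) R)ˣ, (Y : Matrix (Fin 2) (Fin 2) R) = M ∧
        Units.map (embedMatrix R f) Y ∈ rowErasable R l := by
      rcases hL M (by simp) with ⟨i, j, c, hij, rfl⟩ | ⟨d, hd, rfl⟩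
      · obtain ⟨Y, hY⟩ := isUnit_one_add_single hij c
        exact ⟨Y, hY, mem_rowErasable_of_eq_embedMatrix f l Y i j c hY⟩
      · have hu (i : Fin 2) : IsUnit (1 + single i i (d i - 1)) := by
          rw [one_add_single_sub_one_eq_diagonal]
          refine isUnit_diagonal fun k => ?_
          by_cases hk : k = i
          · subst hk; simpa using hd k
          · simp [hk]
        obtain ⟨Y₀, h₀⟩ := hu 0
        obtain ⟨Y₁, h₁⟩ := hu 1
        refine ⟨Y₀ * Y₁, by rw [Units.val_mul, h₀, h₁, diagonal_fin_two_eq], ?_⟩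
        rw [map_mul]
        exact mul_mem (mem_rowErasable_of_eq_embedMatrix f l Y₀ _ _ _ h₀)
          (mem_rowErasable_of_eq_embedMatrix f l Y₁ _ _ _ h₁)
    obtain ⟨Y, rfl, hY⟩ := hM
    have := ih (Y⁻¹ * X) (fun M hM => hL M (by simp [hM])) (by simp [← hX])
    simpa using mul_mem hY this

/-- Column operations on the columns indexed by `insert k t` clear the entries of a row indexed
by `t`. -/
theorem exists_unit_clear [IsDomain R] (hR : IsRightBezout R) (hGE : IsGE2 R) (l k : ι)
    (t : Finset ι) (hk : k ∉ t) (r : ι → R) :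
    ∃ Q : (Matrix ι ι R)ˣ, Q⁻¹ ∈ rowErasable R l ∧
      (∀ j ∈ t, (r ᵥ* (Q : Matrix ι ι R)) j = 0) ∧
      ∀ m ∉ insert k t, (Q : Matrix ι ι R) m = Pi.single m 1 := by
  induction t using Finset.induction_on with
  | empty =>
    refine ⟨1, by simp [one_mem], by simp, fun m _ => ?_⟩
    rw [Units.val_one, one_apply_eq_single]
  | insert j t hj ih =>
    obtain ⟨Q, hQ, hz, hm⟩ := ih fun h => hk (Finset.mem_insert_of_mem h)
    have hkj : k ≠ j := fun h => hk (by simp [h])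
    let f : Fin 2 ↪ ι := ⟨![k, j], by
      intro a b; fin_cases a <;> fin_cases b <;> simp [hkj, hkj.symm]⟩
    obtain ⟨X, d, hX⟩ := hR.exists_unit_vecMul_eq
      ((r ᵥ* (Q : Matrix ι ι R)) k) ((r ᵥ* (Q : Matrix ι ι R)) j)
    -- The block mixes only columns `k` and `j`, moving their entries to `(d, 0)`; the zeros already
    -- obtained persist.
    refine ⟨Q * Units.map (embedMatrix R f) X, ?_, ?_, ?_⟩
    · rw [_root_.mul_inv_rev, ← map_inv]
      exact mul_mem (hGE.map_embedMatrix_mem f l _) hQ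
    · intro i hi
      rw [Units.val_mul, ← vecMul_vecMul, Units.coe_map]
      rcases Finset.mem_insert.1 hi with rfl | hi'
      · have := vecMul_embedMatrix_apply f (X : Matrix (Fin 2) (Fin 2) R)
          (r ᵥ* (Q : Matrix ι ι R)) 1
        have hf : (r ᵥ* (Q : Matrix ι ι R)) ∘ f =
            ![(r ᵥ* (Q : Matrix ι ι R)) k, (r ᵥ* (Q : Matrix ι ι R)) i] := by
          ext p; fin_cases p <;> rfl
        rw [hf, hX] at this
        exact this
      · rw [vecMul_embedMatrix_of_notMem, hz i hi']
        intro p hp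
        fin_cases p
        · obtain rfl : i = k := hp
          exact hk (Finset.mem_insert_of_mem hi')
        · obtain rfl : i = j := hp
          exact hj hi'
    · intro m hm'
      simp only [Finset.mem_insert, not_or] at hm'
      rw [Units.val_mul, mul_apply_eq_vecMul, hm m (by simp [hm'.1, hm'.2.2]),
        single_one_vecMul_eq, Units.coe_map]
      apply embedMatrix_row_of_notMem
      intro p hp
      fin_cases p
      · exact hm'.1 hp
      · exact hm'.2.1 hp

/-- A matrix with a zero row, all of whose other rows outside `s` are those of the identity, is a
product of idempotents. -/
theorem mem_of_row_eq_zero [IsDomain R] (hR : IsRightBezout R) (hGE : IsGE2 R) (l : ι)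
    (s : Finset ι) (hs : l ∉ s) (A : Matrix ι ι R) (hl : A l = 0)
    (hA : ∀ i ∉ insert l s, A i = Pi.single i 1) : A ∈ idempotentProducts (Matrix ι ι R) := by
  induction s using Finset.induction_on generalizing A with
  | empty =>
    have : A = updateRow 1 l 0 := by
      ext i : 1
      by_cases hi : i = l
      · subst hi; rw [hl, updateRow_self]
      · rw [hA i (by simp [hi]), updateRow_ne hi, one_apply_eq_single]
    rw [this]
    exact mem_idempotentProducts_of_isIdempotentElem (isIdempotentElem_updateRow_zero_one R l)
  | insert k s hk ih =>
    simp only [Finset.mem_insert, not_or] at hs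
    -- Clearing column `l` makes the factor carrying row `k` a product of idempotents; clearing the
    -- columns in `s` lets row `k` meet only identity rows in the factorization of `B`.
    obtain ⟨Q, hQ, hz, hm⟩ := exists_unit_clear hR hGE l k (insert l s)
      (by simp [hk, Ne.symm hs.1]) (A k)
    set B : Matrix ι ι R := A * Q.val with hB
    have hBl : B l = 0 := by rw [hB, mul_apply_eq_vecMul, hl, zero_vecMul]
    have hBk (j) (hj : j ∈ insert l s) : B k j = 0 := by
      rw [hB, mul_apply_eq_vecMul]; exact hz j hj
    have hBi (i) (hi : i ∉ insert l (insert k s)) : B i = Pi.single i 1 := by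
      rw [hB, mul_apply_eq_vecMul, hA i hi, single_one_vecMul_eq]
      exact hm i (by rwa [Finset.insert_comm])
    have hB' : updateRow B k (Pi.single k 1) ∈ idempotentProducts (Matrix ι ι R) := by
      apply ih hs.2
      · rw [updateRow_ne hs.1, hBl]
      · intro i hi
        by_cases hik : i = k
        · subst hik; rw [updateRow_self]
        · rw [updateRow_ne hik]
          exact hBi i (by simp_all)
    have hBeq : B = updateRow (updateRow 1 k (B k)) l 0 * updateRow B k (Pi.single k 1) := by
      have hBk' : B k ᵥ* updateRow B k (Pi.single k 1) = B k := by
        conv_rhs => rw [← vecMul_one (B k)]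
        rw [vecMul_eq_sum, vecMul_eq_sum]
        refine Finset.sum_congr rfl fun i _ => ?_
        rw [one_apply_eq_single]
        by_cases hik : i = k
        · subst hik; rw [updateRow_self]
        rw [updateRow_ne hik]
        by_cases hi : i ∈ insert l s
        · rw [hBk i hi, zero_smul, zero_smul]
        · rw [hBi i (by simp_all)]
      rw [updateRow_mul, zero_vecMul, updateRow_mul, one_mul, hBk', updateRow_idem,
        updateRow_eq_self, ← hBl, updateRow_eq_self]
    have hBmem : B ∈ idempotentProducts (Matrix ι ι R) := by
      rw [hBeq]
      exact mul_mem (updateRow_updateRow_mem k l (Ne.symm hs.1) _ (hBk l (by simp))) hB'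
    -- Since row `l` of `B` vanishes, erasing it changes nothing; this inserts the idempotent needed
    -- to absorb `Q⁻¹`.
    have hAB : A = (updateRow 1 l 0 * (Q⁻¹).val) * ((Q⁻¹)⁻¹.val * B * (Q⁻¹).val) := by
      have : updateRow 1 l 0 * B = B := by
        rw [updateRow_zero_one_mul, ← hBl, updateRow_eq_self]
      calc A = B * (Q⁻¹).val := by rw [hB, Units.mul_inv_cancel_right]
        _ = updateRow 1 l 0 * B * (Q⁻¹).val := by rw [this]
        _ = _ := by simp only [inv_inv, mul_assoc, Units.inv_mul_cancel_left]
    rw [hAB]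
    exact mul_mem hQ (conj_mem_idempotentProducts Q⁻¹ hBmem)

/-- A nonzero row killing `A` from the left becomes `d` times a basis row after a change of basis;
cancelling `d ≠ 0` leaves a zero row in the conjugate of `A`. -/
theorem mem_of_isLeftSingular [IsDomain R] (hR : IsRightBezout R) (hGE : IsGE2 R)
    (A : Matrix ι ι R) (hA : IsLeftSingular A) : A ∈ idempotentProducts (Matrix ι ι R) := by
  obtain ⟨C, hC, hCA⟩ := hA
  obtain ⟨i, hi⟩ := Function.ne_iff.1 hC
  obtain ⟨Q, -, hz, -⟩ := exists_unit_clear hR hGE i i (Finset.univ.erase i) (by simp) (C i)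
  have hQ : C i ᵥ* (Q : Matrix ι ι R) = Pi.single i ((C i ᵥ* (Q : Matrix ι ι R)) i) := by
    ext j
    by_cases hj : j = i
    · subst hj; simp
    · rw [hz j (by simp [hj])]; simp [hj]
  set d := (C i ᵥ* (Q : Matrix ι ι R)) i with hd
  have hd0 : d ≠ 0 := by
    intro h0
    apply hi
    have : C i ᵥ* (Q : Matrix ι ι R) ᵥ* (Q⁻¹).val = 0 := by
      rw [hQ, h0, Pi.single_zero, zero_vecMul]
    rwa [vecMul_vecMul, Units.mul_inv, vecMul_one] at this
  have hrow : ((Q⁻¹).val * A * Q.val) i = 0 := by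
    have h1 : (C i ᵥ* (Q : Matrix ι ι R)) ᵥ* ((Q⁻¹).val * A * Q.val) = 0 := by
      rw [vecMul_vecMul, mul_assoc, Units.mul_inv_cancel_left, ← vecMul_vecMul,
        ← mul_apply_eq_vecMul, hCA]
      exact zero_vecMul _
    rw [hQ, single_vecMul] at h1
    exact (smul_eq_zero.1 h1).resolve_left hd0
  have := mem_of_row_eq_zero hR hGE i (Finset.univ.erase i) (by simp) _ hrow (by simp)
  have h2 := conj_mem_idempotentProducts Q⁻¹ this
  simpa [mul_assoc] using h2

theorem IsGE2.hasIP [IsDomain R] (hGE : IsGE2 R) (hR : IsRightBezout R) : HasIP R :=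
  fun _ A hA => .of_mem (mem_of_isLeftSingular hR hGE A hA.1)

end GE

/-! ### Stable range one implies GE₂ -/

section StableRange

variable {R : Type*} [Ring R]

theorem HasStableRangeOne.isGE2 (h : HasStableRangeOne R) : IsGE2 R := by
  rintro _ ⟨A, rfl⟩
  obtain ⟨x, u, hu⟩ : ∃ x, IsUnit (A.1 0 0 + A.1 0 1 * x) := by
    apply h
    have h1 : A.1 0 0 * A.2 0 0 + A.1 0 1 * A.2 1 0 = 1 := by
      have := congrFun (congrFun A.3 0) 0
      rwa [mul_apply, Fin.sum_univ_two] at this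
    rw [eq_top_iff]
    rintro z -
    have h2 : z = MulOpposite.op (A.2 0 0 * z) • A.1 0 0 +
        MulOpposite.op (A.2 1 0 * z) • A.1 0 1 := by
      simp only [op_smul_eq_mul, ← mul_assoc, ← add_mul, h1, one_mul]
    rw [h2]
    exact Submodule.add_mem_sup (Submodule.smul_mem _ _ (Submodule.mem_span_singleton_self _))
      (Submodule.smul_mem _ _ (Submodule.mem_span_singleton_self _))
  have h10 : (1 : Fin 2) ≠ 0 := by decide
  obtain ⟨c, hc⟩ : ∃ c, c = A.1 1 0 + A.1 1 1 * x := ⟨_, rfl⟩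
  -- Adding the second column times `x` to the first makes the corner the unit `u`; `v` is then the
  -- Schur complement.
  obtain ⟨v, hv⟩ : ∃ v, v = A.1 1 1 - c * ↑u⁻¹ * A.1 0 1 := ⟨_, rfl⟩
  have hA : A.1 = (1 + single 1 0 (c * ↑u⁻¹)) * diagonal ![↑u, v] *
      (1 + single 0 1 (↑u⁻¹ * A.1 0 1)) * (1 + single 1 0 (-x)) := by
    have h₁ (c : R) : 1 + single 1 0 c = !![1, 0; c, 1] := by
      ext i j; fin_cases i <;> fin_cases j <;> simp
    have h₂ (c : R) : 1 + single 0 1 c = !![1, c; 0, 1] := by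
      ext i j; fin_cases i <;> fin_cases j <;> simp
    have h₃ (a b : R) : diagonal ![a, b] = !![a, 0; 0, b] := by
      ext i j; fin_cases i <;> fin_cases j <;> simp
    rw [h₁, h₁, h₂, h₃]
    ext i j
    fin_cases i <;> fin_cases j <;> simp [Matrix.mul_apply, Fin.sum_univ_two, hv, mul_assoc]
    · simp [hu]
    · simp [hc]
  obtain ⟨E₁, hE₁⟩ := isUnit_one_add_single h10 (c * ↑u⁻¹)
  obtain ⟨E₂, hE₂⟩ := isUnit_one_add_single h10.symm (↑u⁻¹ * A.1 0 1)
  obtain ⟨E₃, hE₃⟩ := isUnit_one_add_single h10 (-x)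
  have hD : IsUnit (diagonal ![↑u, v]) := by
    rw [← hE₁, ← hE₂, ← hE₃] at hA
    have := A.isUnit
    rwa [hA, Units.isUnit_mul_units, Units.isUnit_mul_units, Units.isUnit_units_mul] at this
  have hvu : IsUnit v := by
    obtain ⟨D, hD⟩ := hD
    refine ⟨⟨v, D.2 1 1, ?_, ?_⟩, rfl⟩
    · have := congrFun (congrFun D.3 1) 1
      rw [hD] at this
      simpa using this
    · have := congrFun (congrFun D.4 1) 1
      rw [hD] at this
      simpa using this
  refine ⟨[1 + single 1 0 (c * ↑u⁻¹), diagonal ![↑u, v], 1 + single 0 1 (↑u⁻¹ * A.1 0 1),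
    1 + single 1 0 (-x)], ?_, ?_⟩
  swap
  · conv_rhs => rw [hA]
    simp [mul_assoc]
  intro M hM
  simp only [List.mem_cons, List.not_mem_nil, or_false] at hM
  rcases hM with rfl | rfl | rfl | rfl
  · exact .inl ⟨_, _, _, h10, rfl⟩
  · exact .inr ⟨_, fun i => by fin_cases i <;> simp [hvu], rfl⟩
  · exact .inl ⟨_, _, _, h10.symm, rfl⟩
  · exact .inl ⟨_, _, _, h10, rfl⟩

end StableRange

end IdempotentProducts

theorem mainTheorem1 {R : Type*} [Ring R] [IsDomain R]
    (hR : IdempotentProducts.IsBezoutRing R) :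
    (IdempotentProducts.HasIP2 R → IdempotentProducts.IsGE2 R → IdempotentProducts.HasIP R) ∧
      (IdempotentProducts.HasStableRangeOne R → IdempotentProducts.HasIP R) :=
  ⟨fun _ hGE => hGE.hasIP hR.1, fun h => h.isGE2.hasIP hR.1⟩
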